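/- A metric space $(X,d)$ is \emph{doubling with constant} $D$ if every ball of radius $r>0$ in $X$ can be covered by at most $D$ balls of radius $r/2$. A Borel measure $\mu$ on $\mathbb{R}^N$ is \emph{doubling with constant} $K$ if $0<\mu(B[x,r])<\infty$ and $\mu(B[x,2r])\le K\,\mu(B[x,r])$ for all $x\in\mathbb{R}^N$, $r>0$, where $B[x,r]$ is the closed Euclidean ball; put $$q_{\mu,1/N}(x,y)=\Big(\mu\big(B[x,|x-y|]\big)+\mu\big(B[y,|x-y|]\big)\Big)^{1/N}.$$ A doubling measure $\mu$ is a \emph{metric doubling measure} if there are a metric $d_{1/N}$ on $\mathbb{R}^N$ and a constant $C\ge 1$ with $C^{-1}d_{1/N}\le q_{\mu,1/N}\le C\,d_{1/N}$. For a metric space $S$, a subset $A\subseteq S$ is an \emph{$\varepsilon$-net} if the open balls of $S$ of radius $\varepsilon$ centred at the points of $A$ cover $S$, and is \emph{$r$-packed} if the open balls of $S$ of radius $r$ centred at distinct points of $A$ are disjoint (a minimal $\varepsilon$-net is an $\varepsilon$-net that is $\varepsilon/2$-packed). \textbf{Theorem.} For every $D\in\mathbb{N}$ there are an integer $N\ge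 1$ and constants $K,C,L\ge 1$, depending only on $D$, such that the following holds for every metric space $(X,d)$ that is doubling with constant $D$. There are a metric doubling measure $\mu$ on $\mathbb{R}^N$ with doubling constant $K$, a metric $d_{1/N}$ on $\mathbb{R}^N$ with $C^{-1}d_{1/N}\le q_{\mu,1/N}\le C\,d_{1/N}$, and a map $f:X\to\mathbb{R}^N$ such that (1) $L^{-1}d(x,y)\le d_{1/N}(f(x),f(y))\le L\,d(x,y)$ for all $x,y\in X$, i.e. $(X,d)$ is $L$-bilipschitz equivalent to the subset $f(X)$ of $(\mathbb{R}^N,d_{1/N})$; (2) $f$ matches the samplings of $(X,d)$ and of $(f(X),d_{1/N})$: for all $\varepsilon,r>0$, if $A\subseteq X$ is an $\varepsilon$-net (respectively $r$-packed) in $X$, then $f(A)$ is an $L\varepsilon$-net (respectively $r/L$-packed) in $f(X)$; and if $B\subseteq f(X)$ is an $\varepsilon$-net (respectively $r$-packed) in $f(X)$, then $f^{-1}(B)$ is an $L\varepsilon$-net (respectively $r/L$-packed) in $X$. -/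

import Mathlib

open MeasureTheory Metric Set

/-- A metric space is doubling with constant `D` if every ball of radius `r` is covered by at most
`D` balls of radius `r / 2`. -/
def IsDoublingSpace (X : Type*) [MetricSpace X] (D : ℕ) : Prop :=
  ∀ (x : X) (r : ℝ), 0 < r →
    ∃ t : Finset X, t.card ≤ D ∧ ball x r ⊆ ⋃ y ∈ t, ball y (r / 2)

/-- A doubling measure with constant `K`: closed balls of positive radius have positive and finite
measure, and `μ (B[x, 2r]) ≤ K * μ (B[x, r])` for every centre and every radius. -/
structure IsDoublingMeasure {Y : Type*} [MetricSpace Y] [MeasurableSpace Y]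
    (μ : Measure Y) (K : ℝ) : Prop where
  pos : ∀ (x : Y) (r : ℝ), 0 < r → 0 < μ (closedBall x r)
  finite : ∀ (x : Y) (r : ℝ), 0 < r → μ (closedBall x r) < ⊤
  doubling : ∀ (x : Y) (r : ℝ), 0 < r →
    μ (closedBall x (2 * r)) ≤ ENNReal.ofReal K * μ (closedBall x r)

/-- The quasimetric `q_{μ,s}(x,y) = (μ (B[x, d(x,y)]) + μ (B[y, d(x,y)])) ^ s`. -/
noncomputable def measureQuasimetric {Y : Type*} [MetricSpace Y] [MeasurableSpace Y]
    (μ : Measure Y) (s : ℝ) (x y : Y) : ℝ :=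
  ((μ (closedBall x (dist x y))).toReal + (μ (closedBall y (dist x y))).toReal) ^ s

/-- `δ` is a metric on `Y` (nonnegativity follows from the three axioms). -/
structure IsMetric {Y : Type*} (δ : Y → Y → ℝ) : Prop where
  eq_zero_iff : ∀ x y, δ x y = 0 ↔ x = y
  symm : ∀ x y, δ x y = δ y x
  triangle : ∀ x y z, δ x z ≤ δ x y + δ y z

/-- `ρ` and `σ` are comparable with constant `C`. -/
def AreComparable {Y : Type*} (ρ σ : Y → Y → ℝ) (C : ℝ) : Prop :=
  ∀ x y, C⁻¹ * ρ x y ≤ σ x y ∧ σ x y ≤ C * ρ x y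

/-- `μ` is a metric doubling measure on `ℝ^N` (with doubling constant `K`), as witnessed by the
metric `δ`, which is comparable with constant `C` to the quasimetric `q_{μ,1/N}`. -/
structure IsMetricDoublingMeasure {N : ℕ} (μ : Measure (EuclideanSpace ℝ (Fin N)))
    (δ : EuclideanSpace ℝ (Fin N) → EuclideanSpace ℝ (Fin N) → ℝ) (K C : ℝ) : Prop where
  doubling : IsDoublingMeasure μ K
  metric : IsMetric δ
  comparable : AreComparable δ (measureQuasimetric μ (1 / (N : ℝ))) C

/-- `f : (X, ρ) → (Y, σ)` is bilipschitz (onto its image) with constant `L`. -/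
def IsBilipschitz {X Y : Type*} (ρ : X → X → ℝ) (σ : Y → Y → ℝ) (f : X → Y) (L : ℝ) : Prop :=
  ∀ x y, L⁻¹ * ρ x y ≤ σ (f x) (f y) ∧ σ (f x) (f y) ≤ L * ρ x y

/-- `A` is an `ε`-net of the metric space `(S, ρ)`: the balls of radius `ε` of `S` centred at the
points of `A` cover `S`. -/
def IsNetOf {Y : Type*} (ρ : Y → Y → ℝ) (S A : Set Y) (ε : ℝ) : Prop :=
  A ⊆ S ∧ ∀ x ∈ S, ∃ a ∈ A, ρ a x < ε

/-- `A` is `r`-packed in the metric space `(S, ρ)`: the balls of radius `r` of `S` centred at the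
points of `A` are pairwise disjoint. A minimal `ε`-net is an `ε`-net that is `ε / 2`-packed. -/
def IsPackedIn {Y : Type*} (ρ : Y → Y → ℝ) (S A : Set Y) (r : ℝ) : Prop :=
  A ⊆ S ∧ ∀ a ∈ A, ∀ b ∈ A, a ≠ b → Disjoint {x ∈ S | ρ a x < r} {x ∈ S | ρ b x < r}

/-- Sampling of the metric space `(X, ρ)` and of the subset `f(X)` of `(Y, σ)` correspond to each
other under `f` with constant `L`: in both directions, `ε`-nets go to `L ε`-nets and `r`-packed
sets to `r / L`-packed sets. -/
structure IsSamplingEquivalence {X Y : Type*} (ρ : X → X → ℝ) (σ : Y → Y → ℝ)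
    (f : X → Y) (L : ℝ) : Prop where
  net_image : ∀ (A : Set X) (ε : ℝ), 0 < ε →
    IsNetOf ρ univ A ε → IsNetOf σ (range f) (f '' A) (L * ε)
  net_preimage : ∀ (B : Set Y) (ε : ℝ), 0 < ε →
    IsNetOf σ (range f) B ε → IsNetOf ρ univ (f ⁻¹' B) (L * ε)
  packed_image : ∀ (A : Set X) (r : ℝ), 0 < r →
    IsPackedIn ρ univ A r → IsPackedIn σ (range f) (f '' A) (r / L)
  packed_preimage : ∀ (B : Set Y) (r : ℝ), 0 < r →
    IsPackedIn σ (range f) B r → IsPackedIn ρ univ (f ⁻¹' B) (r / L)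

/-!
A doubling space embeds into a Euclidean space after its metric is replaced by its square root, and
a density vanishing on the image then turns the square root back into the original metric.

The first step is Assouad's embedding theorem (`IsDoublingSpace.exists_snowflake_embedding`): at each
scale `4 ^ n` a net is split into boundedly many colour classes of well separated points, the tent
functions around these classes are multiplied by `2 ^ n`, and the products are summed over `n` in a
fixed residue class modulo `9`. The result is a map `f` with `|f x - f y| ^ 2` comparable to
`d(x, y)`. A spare zero coordinate makes the image `E = f(X)` a subset of a
hyperplane, hence porous.

Let `h = dist(·, E)` and let `μ` be Lebesgue measure with density `h ^ N`. Since `E` is porous,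
`μ (B[x, r])` is comparable to `(r (h x + r)) ^ N`. Hence `μ` is doubling, and its quasimetric is
comparable to `ρ(x, y) = |x - y| (|x - y| + h x + h y)`, which equals `|x - y| ^ 2` on `E`.

It remains to compare `ρ` with a metric (`exists_isMetric_comparable_weightedDist`). The supremum of
`|g x - g y|` over all functions `g` that are `1`-Lipschitz with respect to `ρ` is a metric bounded
by `ρ`, so it suffices to find, for given `x` and `y`, one such `g` with `|g x - g y|` at least a
constant times `ρ(x, y)`. If `h x` is not small compared with `|x - y|`, a truncated distance to `x`
will do (`exists_truncated_dist`). Otherwise `x` is close to some `f p`, and `g` is the infimal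
convolution of `d(p, ·)` with a large multiple of the squared distance
(`exists_quadratic_extension`). This is where `|f x - f y| ^ 2` being comparable to a metric enters.

Finally, a bilipschitz map onto its image matches nets and packings.
-/

/-! ### Separated sets and coloured nets -/

theorem exists_maximal_separated_subset {X : Type*} [MetricSpace X] (S : Set X) {R : ℝ}
    (hR : 0 < R) :
    ∃ A ⊆ S, (∀ a ∈ A, ∀ b ∈ A, a ≠ b → R ≤ dist a b) ∧ ∀ s ∈ S, ∃ a ∈ A, dist s a < R := by
  obtain ⟨A, hA⟩ := zorn_subset {A : Set X | A ⊆ S ∧ A.Pairwise fun a b => R ≤ dist a b} (by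
    intro c hc hchain
    refine ⟨⋃₀ c, ⟨sUnion_subset fun s hs => (hc hs).1, ?_⟩, fun s hs => subset_sUnion_of_mem hs⟩
    exact (pairwise_sUnion hchain.directedOn).2 fun s hs => (hc hs).2)
  refine ⟨A, hA.prop.1, hA.prop.2, fun s hs => ?_⟩
  by_contra! hfar
  have hins : insert s A ∈ {A : Set X | A ⊆ S ∧ A.Pairwise fun a b => R ≤ dist a b} := by
    refine ⟨insert_subset hs hA.prop.1, hA.prop.2.insert fun b hb _ => ⟨hfar b hb, ?_⟩⟩
    rw [dist_comm]
    exact hfar b hb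
  have hsA : s ∈ A := hA.le_of_ge hins (subset_insert s A) (mem_insert s A)
  have := hfar s hsA
  rw [dist_self] at this
  linarith

/-- A greedy colouring: a maximal `R`-separated subset meets every ball of radius `R`, so that
removing it as one colour class lowers the bound on the number of neighbours. -/
theorem exists_separated_coloring {X : Type*} [MetricSpace X] {R : ℝ} (hR : 0 < R) (M : ℕ)
    (S : Set X) (hS : ∀ a ∈ S, (S ∩ ball a R).encard ≤ M) :
    ∃ A : Fin M → Set X, (∀ κ, ∀ a ∈ A κ, ∀ b ∈ A κ, a ≠ b → R ≤ dist a b) ∧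
      ∀ s ∈ S, ∃ κ, s ∈ A κ := by
  induction M generalizing S with
  | zero =>
    refine ⟨fun _ => ∅, by simp, fun s hs => ?_⟩
    have h0 : S ∩ ball s R = ∅ := by simpa using hS s hs
    have hmem : s ∈ S ∩ ball s R := ⟨hs, mem_ball_self hR⟩
    simp [h0] at hmem
  | succ M ih =>
    obtain ⟨A, hAS, hsep, hnet⟩ := exists_maximal_separated_subset S hR
    obtain ⟨c, hc, hcov⟩ := ih (S \ A) (by
      intro a ha
      obtain ⟨b, hb, hab⟩ := hnet a ha.1
      have hbmem : b ∉ (S \ A) ∩ ball a R := fun h => h.1.2 hb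
      have hsub : insert b ((S \ A) ∩ ball a R) ⊆ S ∩ ball a R :=
        insert_subset ⟨hAS hb, by rwa [mem_ball, dist_comm]⟩
          (inter_subset_inter_left _ sdiff_subset)
      have hle := (encard_le_encard hsub).trans (hS a ha.1)
      rw [encard_insert_of_notMem hbmem] at hle
      push_cast at hle
      exact (ENat.add_le_add_iff_right ENat.one_ne_top).1 hle)
    refine ⟨Fin.snoc (α := fun _ => Set X) c A, fun κ => ?_, fun s hs => ?_⟩
    · refine Fin.lastCases ?_ (fun j => ?_) κ
      · simpa using hsep
      · simpa using hc j
    · by_cases hsA : s ∈ A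
      · exact ⟨Fin.last M, by simpa using hsA⟩
      · obtain ⟨κ, hκ⟩ := hcov s ⟨hs, hsA⟩
        exact ⟨κ.castSucc, by simpa using hκ⟩

theorem IsDoublingSpace.exists_cover_pow {X : Type*} [MetricSpace X] {D : ℕ}
    (hX : IsDoublingSpace X D) (k : ℕ) (x : X) {r : ℝ} (hr : 0 < r) :
    ∃ t : Finset X, t.card ≤ D ^ k ∧ ball x r ⊆ ⋃ y ∈ t, ball y (r / 2 ^ k) := by
  classical
  induction k with
  | zero => exact ⟨{x}, by simp, by simp⟩
  | succ k ih =>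
    obtain ⟨t, ht, hcov⟩ := ih
    choose u hu hucov using fun y : X => hX y (r / 2 ^ k) (by positivity)
    refine ⟨t.biUnion u, ?_, fun z hz => ?_⟩
    · calc (t.biUnion u).card ≤ t.card * D := Finset.card_biUnion_le_card_mul _ _ _ fun y _ => hu y
        _ ≤ D ^ k * D := by gcongr
        _ = D ^ (k + 1) := (pow_succ _ _).symm
    · obtain ⟨y, hy, hzy⟩ := mem_iUnion₂.1 (hcov hz)
      obtain ⟨w, hw, hzw⟩ := mem_iUnion₂.1 (hucov y hzy)
      refine mem_iUnion₂.2 ⟨w, Finset.mem_biUnion.2 ⟨y, hy, hw⟩, ?_⟩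
      rwa [pow_succ, ← div_div]

theorem IsDoublingSpace.encard_separated_inter_ball_le {X : Type*} [MetricSpace X] {D : ℕ}
    (hX : IsDoublingSpace X D) {S : Set X} {ε : ℝ} (hε : 0 < ε)
    (hS : ∀ a ∈ S, ∀ b ∈ S, a ≠ b → ε ≤ dist a b) (k : ℕ) (x : X) :
    (S ∩ ball x (2 ^ k * ε)).encard ≤ (D ^ (k + 1) : ℕ) := by
  obtain ⟨t, ht, hcov⟩ := hX.exists_cover_pow (k + 1) x (r := 2 ^ k * ε) (by positivity)
  have hrad : 2 ^ k * ε / 2 ^ (k + 1) = ε / 2 := by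
    rw [pow_succ]
    field_simp
  rw [hrad] at hcov
  have hex : ∀ z ∈ S ∩ ball x (2 ^ k * ε), ∃ y ∈ t, dist z y < ε / 2 := fun z hz => by
    simpa using hcov hz.2
  choose! g hg hgd using hex
  calc (S ∩ ball x (2 ^ k * ε)).encard ≤ (t : Set X).encard := by
        refine encard_le_encard_of_injOn (f := g) (fun z hz => hg z hz) fun z hz w hw hzw => ?_
        by_contra hne
        have h1 := hS z hz.1 w hw.1 hne
        have h2 := hgd z hz
        have h3 := hgd w hw
        have h4 := dist_triangle_right z w (g z)
        rw [← hzw] at h3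
        linarith
    _ = t.card := encard_coe_eq_coe_finsetCard t
    _ ≤ _ := by exact_mod_cast ht

/-- In a doubling space, at each scale there is an `ε`-net splitting into a bounded number of
`40 ε`-separated colour classes. -/
theorem IsDoublingSpace.exists_colored_net {X : Type*} [MetricSpace X] {D : ℕ}
    (hX : IsDoublingSpace X D) {ε : ℝ} (hε : 0 < ε) :
    ∃ A : Fin (D ^ 7) → Set X, (∀ κ, ∀ a ∈ A κ, ∀ b ∈ A κ, a ≠ b → 40 * ε ≤ dist a b) ∧
      ∀ x, ∃ κ, ∃ a ∈ A κ, dist x a < ε := by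
  obtain ⟨S, -, hsep, hnet⟩ := exists_maximal_separated_subset (univ : Set X) hε
  obtain ⟨A, hA, hcov⟩ := exists_separated_coloring (R := 40 * ε) (by positivity) (D ^ 7) S
    (fun a _ => (encard_le_encard (inter_subset_inter_right _
      (ball_subset_ball (by linarith)))).trans
      (hX.encard_separated_inter_ball_le hε hsep 6 a))
  refine ⟨A, hA, fun x => ?_⟩
  obtain ⟨a, ha, hxa⟩ := hnet x (mem_univ x)
  obtain ⟨κ, hκ⟩ := hcov a ha
  exact ⟨κ, a, hκ, hxa⟩

/-! ### Two-sided geometric series -/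

theorem hasSum_geometric_natAbs :
    HasSum (fun k : ℤ => (1 / 512 : ℝ) ^ k.natAbs) (513 / 511) := by
  have h := hasSum_geometric_of_lt_one (r := (1 / 512 : ℝ)) (by norm_num) (by norm_num)
  have h2 := h.mul_left (1 / 512 : ℝ)
  convert HasSum.of_nat_of_neg_add_one (f := fun k : ℤ => (1 / 512 : ℝ) ^ k.natAbs)
    (m := (1 - 1 / 512)⁻¹) (m' := 1 / 512 * (1 - 1 / 512)⁻¹) (by simpa using h) ?_ using 1
  · norm_num
  · have hterm : ∀ n : ℕ, (1 / 512 : ℝ) ^ (-((n : ℤ) + 1)).natAbs = 1 / 512 * (1 / 512) ^ n :=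
      fun n => by
        rw [← pow_succ']
        congr 1
    simpa only [hterm] using h2

theorem summable_and_abs_tsum_sub_le {a : ℤ → ℝ} {B : ℝ} (k₀ : ℤ)
    (ha : ∀ k, |a k| ≤ B * (1 / 512) ^ (k - k₀).natAbs) :
    Summable a ∧ |∑' k, a k - a k₀| ≤ B / 128 := by
  have hB : 0 ≤ B := by simpa using (abs_nonneg _).trans (ha k₀)
  have hgeom : HasSum (fun k => B * (1 / 512 : ℝ) ^ (k - k₀).natAbs) (B * (513 / 511)) :=
    ((Equiv.subRight k₀).hasSum_iff.2 hasSum_geometric_natAbs).mul_left B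
  have hsum : Summable a := Summable.of_norm_bounded hgeom.summable ha
  refine ⟨hsum, ?_⟩
  have h1 := hsum.hasSum.sub (hasSum_ite_eq k₀ (a k₀))
  have h2 := hgeom.sub (hasSum_ite_eq k₀ B)
  have h3 := tsum_of_norm_bounded (f := fun k => a k - if k = k₀ then a k₀ else 0) h2 fun k => by
    by_cases hk : k = k₀
    · simp [hk]
    · simpa [hk] using ha k
  rw [h1.tsum_eq, Real.norm_eq_abs] at h3
  linarith

/-! ### The snowflake embedding -/

/-- A tent function equal to `1` on `A`, decreasing with slope `1 / (2 ε)` away from it. For empty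
`A` it is the constant `1`, by the convention for `infDist`; the Lipschitz bound still holds. -/
noncomputable def tent {X : Type*} [MetricSpace X] (A : Set X) (ε : ℝ) (x : X) : ℝ :=
  max 0 (1 - infDist x A / (2 * ε))

theorem abs_tent_sub_le_one {X : Type*} [MetricSpace X] (A : Set X) {ε : ℝ} (hε : 0 < ε)
    (x y : X) : |tent A ε x - tent A ε y| ≤ 1 := by
  have h : ∀ z, 0 ≤ tent A ε z ∧ tent A ε z ≤ 1 := fun z =>
    ⟨le_max_left _ _, max_le zero_le_one
      (sub_le_self _ (div_nonneg infDist_nonneg (by positivity)))⟩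
  rw [abs_sub_le_iff]
  constructor <;> linarith [(h x).1, (h x).2, (h y).1, (h y).2]

theorem abs_tent_sub_le_dist {X : Type*} [MetricSpace X] (A : Set X) {ε : ℝ} (hε : 0 < ε)
    (x y : X) : |tent A ε x - tent A ε y| ≤ dist x y / ε := by
  have h1 : |infDist x A - infDist y A| ≤ dist x y := by
    simpa [Real.dist_eq] using (lipschitz_infDist_pt A).dist_le_mul x y
  calc |tent A ε x - tent A ε y|
      ≤ |(1 - infDist x A / (2 * ε)) - (1 - infDist y A / (2 * ε))| := by
        rw [tent, tent, max_comm 0, max_comm 0]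
        exact abs_max_sub_max_le_abs _ _ _
    _ = |infDist x A - infDist y A| / (2 * ε) := by
        rw [sub_sub_sub_cancel_left, ← sub_div, abs_div, abs_of_pos (by positivity : 0 < 2 * ε),
          abs_sub_comm]
    _ ≤ dist x y / (1 * ε) := by
        gcongr
        norm_num
    _ = _ := by rw [one_mul]

/-- At a scale comparable to `dist x y`, the colour class with a point near `x` sees no point
near `y`. -/
theorem le_abs_tent_sub {X : Type*} [MetricSpace X] {A : Set X} {ε : ℝ} (hε : 0 < ε)
    (hA : ∀ a ∈ A, ∀ b ∈ A, a ≠ b → 40 * ε ≤ dist a b) {x y a : X} (ha : a ∈ A)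
    (hxa : dist x a < ε) (h8 : 8 * ε ≤ dist x y) (h32 : dist x y < 32 * ε) :
    1 / 2 ≤ |tent A ε x - tent A ε y| := by
  have hx : 1 / 2 ≤ tent A ε x := by
    refine le_trans ?_ (le_max_right _ _)
    have h1 : infDist x A ≤ ε := (infDist_le_dist_of_mem ha).trans hxa.le
    have h2 : infDist x A / (2 * ε) ≤ 1 / 2 := by
      rw [div_le_div_iff₀ (by positivity) (by norm_num)]
      linarith
    linarith
  have hy : tent A ε y = 0 := by
    refine max_eq_left ?_
    have h1 : 2 * ε ≤ infDist y A := by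
      refine (le_infDist ⟨a, ha⟩).2 fun b hb => ?_
      rcases eq_or_ne a b with rfl | hab
      · have := dist_triangle_right x y a
        linarith
      · have h1 := hA a ha b hb hab
        have h2 := dist_triangle4 a x y b
        rw [dist_comm a x] at h2
        linarith
    have h2 : 1 ≤ infDist y A / (2 * ε) := by
      rw [le_div_iff₀ (by positivity)]
      linarith
    linarith
  rw [hy, sub_zero]
  exact hx.trans (le_abs_self _)

/-- The contribution of the scale `4 ^ n` to the snowflake embedding at distance about `4 ^ n₀`:
it decays geometrically both for `n` above `n₀`, by the Lipschitz bound, and for `n` below `n₀`, by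
the trivial bound. -/
theorem abs_le_of_scale {d b : ℝ} {n₀ n e t : ℤ} (hd : d < 32 * 4 ^ n₀) (hn : n = n₀ + e + 9 * t)
    (h1 : |b| ≤ 1) (h2 : |b| ≤ d / 4 ^ n) :
    |(2 : ℝ) ^ n * b| ≤ 32 * 2 ^ n₀ * 2 ^ e.natAbs * (1 / 512) ^ t.natAbs := by
  have h4 : ∀ j : ℤ, (4 : ℝ) ^ j = 2 ^ j * 2 ^ j := fun j => by
    rw [← mul_zpow]
    norm_num
  have h512 : ∀ j : ℤ, (2 : ℝ) ^ (9 * j) = 512 ^ j := fun j => by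
    rw [zpow_mul]
    norm_num
  have hpos : ∀ j : ℤ, (0 : ℝ) < 2 ^ j := fun j => by positivity
  have hsplit : (2 : ℝ) ^ n = 2 ^ n₀ * 2 ^ e * 512 ^ t := by
    rw [hn, zpow_add₀ two_ne_zero, zpow_add₀ two_ne_zero, h512]
  have he : ∀ j : ℤ, j ≤ e.natAbs → (2 : ℝ) ^ j ≤ 2 ^ e.natAbs := fun j hj => by
    rw [← zpow_natCast]
    exact zpow_le_zpow_right₀ one_le_two hj
  rw [abs_mul, abs_of_pos (hpos n)]
  rcases le_total t 0 with ht | ht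
  · have hpow : (512 : ℝ) ^ t = (1 / 512) ^ t.natAbs := by
      rw [one_div, ← zpow_natCast, inv_zpow', show -(t.natAbs : ℤ) = t by omega]
    calc (2 : ℝ) ^ n * |b| ≤ 2 ^ n * 1 := by gcongr
      _ = 1 * 2 ^ n₀ * 2 ^ e * (1 / 512) ^ t.natAbs := by rw [hsplit, hpow]; ring
      _ ≤ _ := by
        gcongr
        · norm_num
        · exact he e (by omega)
  · have hpow : ((512 : ℝ) ^ t)⁻¹ = (1 / 512) ^ t.natAbs := by
      rw [one_div, ← zpow_natCast, inv_zpow, show (t.natAbs : ℤ) = t by omega]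
    calc (2 : ℝ) ^ n * |b| ≤ 2 ^ n * (32 * 4 ^ n₀ / 4 ^ n) := by
          gcongr
          exact h2.trans (by gcongr)
      _ = 32 * 4 ^ n₀ * ((2 : ℝ) ^ n)⁻¹ := by
          rw [h4 n]
          have := (hpos n).ne'
          field_simp
      _ = 32 * 2 ^ n₀ * 2 ^ (-e) * (1 / 512) ^ t.natAbs := by
          rw [h4, hsplit, mul_inv, mul_inv, hpow, zpow_neg]
          have := (hpos n₀).ne'
          field_simp
      _ ≤ _ := by
          gcongr
          exact he (-e) (by omega)

theorem exists_scale {d : ℝ} (hd : 0 < d) : ∃ n : ℤ, 8 * 4 ^ n ≤ d ∧ d < 32 * 4 ^ n := by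
  obtain ⟨n, h1, h2⟩ := exists_mem_Ico_zpow (x := d / 8) (y := 4) (by positivity) (by norm_num)
  rw [zpow_add_one₀ (by norm_num)] at h2
  exact ⟨n, by linarith, by linarith⟩

/-- The coordinates of the snowflake embedding. The scales `4 ^ n` are distributed over nine
coordinates according to the class of `n` modulo `9`, so that in each coordinate the consecutive
scales differ by a factor large enough for the scale comparable to `dist x y` to dominate. -/
theorem IsDoublingSpace.exists_snowflake_coordinates {X : Type*} [MetricSpace X] {D : ℕ}
    (hX : IsDoublingSpace X D) (x₀ : X) :
    ∃ F : Fin (D ^ 7) × Fin 9 → X → ℝ,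
      (∀ x y j, |F j x - F j y| ^ 2 ≤ 2 ^ 25 * dist x y) ∧
      ∀ x y, x ≠ y → ∃ j, dist x y ≤ 512 * |F j x - F j y| ^ 2 := by
  choose A hA hnet using fun n : ℤ => hX.exists_colored_net (ε := (4 : ℝ) ^ n) (by positivity)
  let a : Fin (D ^ 7) × Fin 9 → X → X → ℤ → ℝ := fun j x y k =>
    2 ^ ((j.2 : ℤ) + 9 * k) * (tent (A (j.2 + 9 * k) j.1) (4 ^ ((j.2 : ℤ) + 9 * k)) x
      - tent (A (j.2 + 9 * k) j.1) (4 ^ ((j.2 : ℤ) + 9 * k)) y)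
  have hscale : ∀ (j : Fin (D ^ 7) × Fin 9) (x y : X) (n₀ i₀ k₀ : ℤ), dist x y < 32 * 4 ^ n₀ →
      n₀ = i₀ + 9 * k₀ → ∀ k, |a j x y k| ≤
        32 * 2 ^ n₀ * 2 ^ ((j.2 : ℤ) - i₀).natAbs * (1 / 512) ^ (k - k₀).natAbs := by
    intro j x y n₀ i₀ k₀ hd hn k
    exact abs_le_of_scale hd (by rw [hn]; ring) (abs_tent_sub_le_one _ (by positivity) _ _)
      (abs_tent_sub_le_dist _ (by positivity) _ _)
  have hsummable : ∀ j x y, Summable (a j x y) := by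
    intro j x y
    rcases eq_or_ne x y with rfl | hxy
    · simp [a]
    · obtain ⟨n₀, -, hd⟩ := exists_scale (dist_pos.2 hxy)
      exact (summable_and_abs_tsum_sub_le 0 (hscale j x y n₀ n₀ 0 hd (by ring))).1
  have hdiff : ∀ j x y, ∑' k, a j x x₀ k - ∑' k, a j y x₀ k = ∑' k, a j x y k := by
    intro j x y
    rw [← (hsummable j x x₀).tsum_sub (hsummable j y x₀)]
    refine tsum_congr fun k => ?_
    simp only [a]
    ring
  have hsq : ∀ n : ℤ, ((2 : ℝ) ^ n) ^ 2 = 4 ^ n := fun n => by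
    rw [sq, ← mul_zpow]
    norm_num
  refine ⟨fun j x => ∑' k, a j x x₀ k, fun x y j => ?_, fun x y hxy => ?_⟩
  · simp only [hdiff]
    rcases eq_or_ne x y with rfl | hxy
    · simp [a]
    obtain ⟨n₀, h8, h32⟩ := exists_scale (dist_pos.2 hxy)
    have hterm := hscale j x y n₀ (n₀ % 9) (n₀ / 9) h32 (by omega)
    have h1 := (summable_and_abs_tsum_sub_le _ hterm).2
    have h2 := hterm (n₀ / 9)
    rw [sub_self, Int.natAbs_zero, pow_zero, mul_one] at h2
    have hB : 32 * (2 : ℝ) ^ n₀ * 2 ^ ((j.2 : ℤ) - n₀ % 9).natAbs ≤ 32 * 2 ^ n₀ * 2 ^ 8 := by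
      gcongr
      · norm_num
      · omega
    have h3 : |∑' k, a j x y k| ≤ 2 ^ 14 * 2 ^ n₀ := by
      have h4 := abs_sub_abs_le_abs_sub (∑' k, a j x y k) (a j x y (n₀ / 9))
      have h5 : (0 : ℝ) < 2 ^ n₀ := by positivity
      linarith
    calc |∑' k, a j x y k| ^ 2 ≤ (2 ^ 14 * 2 ^ n₀) ^ 2 := by gcongr
      _ = 2 ^ 25 * (8 * 4 ^ n₀) := by
        rw [mul_pow, hsq]
        ring
      _ ≤ _ := by gcongr
  · obtain ⟨n₀, h8, h32⟩ := exists_scale (dist_pos.2 hxy)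
    obtain ⟨κ, p, hp, hxp⟩ := hnet n₀ x
    obtain ⟨i, hi⟩ : ∃ i : Fin 9, (i : ℤ) = n₀ % 9 := ⟨⟨(n₀ % 9).toNat, by omega⟩, by
      simp only
      omega⟩
    have hn₀ : (i : ℤ) + 9 * (n₀ / 9) = n₀ := by omega
    have hterm := hscale (κ, i) x y n₀ i (n₀ / 9) h32 hn₀.symm
    simp only [sub_self, Int.natAbs_zero, pow_zero, mul_one] at hterm
    have h1 := (summable_and_abs_tsum_sub_le _ hterm).2
    have h2 : 2 ^ n₀ * (1 / 2) ≤ |a (κ, i) x y (n₀ / 9)| := by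
      simp only [a, hn₀]
      rw [abs_mul, abs_of_pos (by positivity : (0 : ℝ) < 2 ^ n₀)]
      gcongr
      exact le_abs_tent_sub (by positivity) (hA n₀ κ) hp hxp h8 h32
    have h3 : 2 ^ n₀ / 4 ≤ |∑' k, a (κ, i) x y k| := by
      have h4 := abs_sub_abs_le_abs_sub (a (κ, i) x y (n₀ / 9)) (∑' k, a (κ, i) x y k)
      rw [abs_sub_comm] at h4
      linarith
    refine ⟨(κ, i), ?_⟩
    simp only [hdiff]
    calc dist x y ≤ 512 * (2 ^ n₀ / 4) ^ 2 := by
          rw [div_pow, hsq]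
          linarith
      _ ≤ _ := by gcongr

/-- **Assouad's embedding theorem** for the square-root snowflake, with image in a coordinate
hyperplane. -/
theorem IsDoublingSpace.exists_snowflake_embedding {X : Type*} [MetricSpace X] {D : ℕ}
    (hX : IsDoublingSpace X D) :
    ∃ f : X → EuclideanSpace ℝ (Fin (D ^ 7 * 9 + 1)), (∀ x, f x 0 = 0) ∧
      (∀ x y, dist x y ≤ 512 * dist (f x) (f y) ^ 2) ∧
      ∀ x y, dist (f x) (f y) ^ 2 ≤ (D ^ 7 * 9 : ℕ) * 2 ^ 25 * dist x y := by
  rcases isEmpty_or_nonempty X with hempty | ⟨⟨x₀⟩⟩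
  · exact ⟨fun _ => 0, by simp, fun x => hempty.elim x, fun x => hempty.elim x⟩
  obtain ⟨F, hup, hlow⟩ := hX.exists_snowflake_coordinates x₀
  let f : X → EuclideanSpace ℝ (Fin (D ^ 7 * 9 + 1)) := fun x =>
    WithLp.toLp 2 (Fin.cons 0 fun j => F (finProdFinEquiv.symm j) x)
  have hdist : ∀ x y, dist (f x) (f y) ^ 2 = ∑ j, |F j x - F j y| ^ 2 := by
    intro x y
    rw [EuclideanSpace.dist_eq, Real.sq_sqrt (by positivity), Fin.sum_univ_succ,
      ← finProdFinEquiv.symm.sum_comp]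
    simp [f, Real.dist_eq]
  refine ⟨f, fun x => rfl, fun x y => ?_, fun x y => ?_⟩
  · rcases eq_or_ne x y with rfl | hxy
    · simp
    obtain ⟨j, hj⟩ := hlow x y hxy
    refine hj.trans ?_
    rw [hdist]
    gcongr
    exact Finset.single_le_sum (f := fun j => |F j x - F j y| ^ 2) (fun _ _ => by positivity)
      (Finset.mem_univ j)
  · rw [hdist]
    refine (Finset.sum_le_card_nsmul _ _ _ fun j _ => hup x y j).trans (le_of_eq ?_)
    simp [mul_assoc]

/-! ### Metrics from families of functions -/

/-- A function `ρ` is comparable to a metric as soon as the real functions that are `1`-Lipschitz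
with respect to `ρ` detect `ρ` up to a constant. The metric is the supremum of `|g x - g y|` over
these functions, for which the triangle inequality is automatic. -/
theorem exists_isMetric_of_lipschitz_functions {Y : Type*} {ρ : Y → Y → ℝ} {c : ℝ} (hc : 0 < c)
    (hpos : ∀ x y, x ≠ y → 0 < ρ x y)
    (hsep : ∀ x y, ∃ g : Y → ℝ, (∀ u v, |g u - g v| ≤ ρ u v) ∧ c * ρ x y ≤ |g x - g y|) :
    ∃ δ : Y → Y → ℝ, IsMetric δ ∧ ∀ x y, c * ρ x y ≤ δ x y ∧ δ x y ≤ ρ x y := by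
  let G := {g : Y → ℝ // ∀ u v, |g u - g v| ≤ ρ u v}
  let δ : Y → Y → ℝ := fun x y => ⨆ g : G, |g.1 x - g.1 y|
  have hρ : ∀ x y, 0 ≤ ρ x y := fun x y => by
    obtain ⟨g, hg, -⟩ := hsep x y
    exact (abs_nonneg _).trans (hg x y)
  have : Nonempty G := ⟨⟨fun _ => 0, fun u v => by simpa using hρ u v⟩⟩
  have hbdd : ∀ x y, BddAbove (range fun g : G => |g.1 x - g.1 y|) := fun x y =>
    ⟨ρ x y, by rintro _ ⟨g, rfl⟩; exact g.2 x y⟩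
  have hle : ∀ x y, δ x y ≤ ρ x y := fun x y => ciSup_le fun g => g.2 x y
  have hge : ∀ x y, c * ρ x y ≤ δ x y := fun x y => by
    obtain ⟨g, hg, hgc⟩ := hsep x y
    exact hgc.trans (le_ciSup (hbdd x y) ⟨g, hg⟩)
  refine ⟨δ, ⟨fun x y => ⟨fun h => ?_, ?_⟩, fun x y => ?_, fun x y z => ?_⟩,
    fun x y => ⟨hge x y, hle x y⟩⟩
  · by_contra hne
    have h1 := hge x y
    have h2 := mul_pos hc (hpos x y hne)
    linarith
  · rintro rfl
    simp [δ]
  · simp only [δ, abs_sub_comm]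
  · refine ciSup_le fun g => (abs_sub_le _ (g.1 y) _).trans ?_
    exact add_le_add (le_ciSup (hbdd x y) g) (le_ciSup (hbdd y z) g)

/-! ### The conformally deformed distance -/

/-- The distance from `x` to `y` weighted by the distance to `E`. In `ℝ^N` it is comparable to the
`N`-th root of the mass that the density `dist(·, E) ^ N` gives to the ball with centre `x` and
radius `dist x y`, if `E` is porous. The term `infDist y E` only serves to make it symmetric. -/
noncomputable def weightedDist {Y : Type*} [MetricSpace Y] (E : Set Y) (x y : Y) : ℝ :=
  dist x y * (dist x y + infDist x E + infDist y E)

theorem weightedDist_comm {Y : Type*} [MetricSpace Y] (E : Set Y) (x y : Y) :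
    weightedDist E x y = weightedDist E y x := by
  simp only [weightedDist, dist_comm x y]
  ring

theorem weightedDist_nonneg {Y : Type*} [MetricSpace Y] (E : Set Y) (x y : Y) :
    0 ≤ weightedDist E x y :=
  mul_nonneg dist_nonneg (add_nonneg (add_nonneg dist_nonneg infDist_nonneg) infDist_nonneg)

theorem weightedDist_pos {Y : Type*} [MetricSpace Y] (E : Set Y) {x y : Y} (h : x ≠ y) :
    0 < weightedDist E x y := by
  have h1 := dist_pos.2 h
  have h2 : 0 ≤ infDist x E := infDist_nonneg
  have h3 : 0 ≤ infDist y E := infDist_nonneg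
  exact mul_pos h1 (by linarith)

theorem weightedDist_of_mem {Y : Type*} [MetricSpace Y] {E : Set Y} {x y : Y} (hx : x ∈ E)
    (hy : y ∈ E) : weightedDist E x y = dist x y ^ 2 := by
  simp [weightedDist, infDist_zero_of_mem hx, infDist_zero_of_mem hy, sq]

/-- A one-sided Lipschitz bound implies the two-sided one, `weightedDist` being symmetric. -/
theorem abs_sub_le_of_sub_le_weightedDist {Y : Type*} [MetricSpace Y] {E : Set Y} {g : Y → ℝ}
    {B : ℝ} (h : ∀ u v, g u - g v ≤ B * weightedDist E u v) (u v : Y) :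
    |g u - g v| ≤ B * weightedDist E u v := by
  rw [abs_sub_le_iff]
  exact ⟨h u v, weightedDist_comm E u v ▸ h v u⟩

/-- A truncated multiple of the distance to `x` is Lipschitz for `weightedDist`, because it is
constant outside a ball around `x` on which `dist(·, E)` is at least `dist(x, E) / 2`. -/
theorem exists_truncated_dist {Y : Type*} [MetricSpace Y] {E : Set Y}
    (x y : Y) {ε : ℝ} (hε : 0 < ε) (hε1 : ε ≤ 1) (hx : ε * dist x y ≤ infDist x E) :
    ∃ g : Y → ℝ, (∀ u v, |g u - g v| ≤ weightedDist E u v) ∧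
      ε ^ 2 / 16 * weightedDist E x y ≤ |g x - g y| := by
  set h := infDist x E with hh
  have h0 : 0 ≤ h := infDist_nonneg
  refine ⟨fun u => h / 2 * min (dist u x) (h / 2), fun u v => ?_, ?_⟩
  · have key : ∀ u v, h / 2 * min (dist u x) (h / 2) - h / 2 * min (dist v x) (h / 2)
        ≤ 1 * weightedDist E u v := by
      intro u v
      rw [one_mul]
      rcases le_total (h / 2) (dist v x) with hv | hv
      · rw [min_eq_right hv]
        have h1 : h / 2 * min (dist u x) (h / 2) ≤ h / 2 * (h / 2) := by
          gcongr
          exact min_le_right _ _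
        have := weightedDist_nonneg E u v
        linarith
      · rw [min_eq_left hv]
        have h1 : h / 2 * min (dist u x) (h / 2) ≤ h / 2 * (dist u v + dist v x) := by
          gcongr
          exact (min_le_left _ _).trans (dist_triangle _ _ _)
        have h2 : h ≤ infDist v E + dist v x := by
          rw [dist_comm]
          exact infDist_le_infDist_add_dist
        have h3 : dist u v * (h / 2) ≤ weightedDist E u v := by
          refine mul_le_mul_of_nonneg_left ?_ dist_nonneg
          have h4 : 0 ≤ infDist u E := infDist_nonneg
          have h5 : 0 ≤ dist u v := dist_nonneg
          linarith
        linarith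
    simpa using abs_sub_le_of_sub_le_weightedDist key u v
  · have hR : 0 ≤ dist x y := dist_nonneg
    have hy : infDist y E ≤ h + dist x y := by
      rw [dist_comm]
      exact infDist_le_infDist_add_dist
    have h1 : ε * dist x y / 2 ≤ min (dist y x) (h / 2) := by
      rw [dist_comm y x]
      refine le_min ?_ (by linarith)
      nlinarith
    have h2 : ε * weightedDist E x y ≤ 4 * (dist x y * h) := by
      have : ε * (dist x y + h + infDist y E) ≤ 4 * h := by nlinarith
      calc ε * weightedDist E x y = dist x y * (ε * (dist x y + h + infDist y E)) := by
            rw [weightedDist]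
            ring
        _ ≤ dist x y * (4 * h) := by gcongr
        _ = _ := by ring
    beta_reduce
    rw [dist_self, min_eq_left (by positivity), mul_zero, zero_sub, abs_neg]
    refine le_trans ?_ (le_abs_self _)
    calc ε ^ 2 / 16 * weightedDist E x y = ε / 16 * (ε * weightedDist E x y) := by ring
      _ ≤ ε / 16 * (4 * (dist x y * h)) := by gcongr
      _ = h / 2 * (ε * dist x y / 2) := by ring
      _ ≤ _ := by gcongr

/-- The extension of `d(p, ·)` from the image of `f` to the ambient space by an infimal convolution
with the square of the distance. It is Lipschitz for `weightedDist`: the infimum at `v` is governed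
by points of the image whose distance to `v` is comparable to `dist(v, E)`. -/
theorem exists_quadratic_extension {X Y : Type*} [MetricSpace X] [MetricSpace Y] {f : X → Y}
    {L : ℝ} (hL : 1 ≤ L) (hf1 : ∀ a b, dist a b ≤ L * dist (f a) (f b) ^ 2)
    (hf2 : ∀ a b, dist (f a) (f b) ^ 2 ≤ L * dist a b) (x y : Y) (p : X)
    (hp : dist x (f p) ≤ 1 / (16 * L) * dist x y) :
    ∃ g : Y → ℝ, (∀ u v, |g u - g v| ≤ 15 * L * weightedDist (range f) u v) ∧
      1 / (32 * L) * dist x y ^ 2 ≤ |g x - g y| := by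
  have hL0 : 0 < L := by linarith
  have : Nonempty X := ⟨p⟩
  let t : Y → X → ℝ := fun u e => dist p e + 3 * L * dist u (f e) ^ 2
  have ht : ∀ u e, 0 ≤ t u e := fun u e => by positivity
  have hbdd : ∀ u, BddBelow (range (t u)) := fun u => ⟨0, by rintro _ ⟨e, rfl⟩; exact ht u e⟩
  refine ⟨fun u => ⨅ e, t u e, abs_sub_le_of_sub_le_weightedDist fun u v => ?_, ?_⟩
  · rcases eq_or_ne u v with rfl | huv
    · simp [weightedDist]
    have hR : 0 < dist u v := dist_pos.2 huv
    have hv0 : 0 ≤ infDist v (range f) := infDist_nonneg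
    have hu0 : 0 ≤ infDist u (range f) := infDist_nonneg
    -- `s` exceeds `dist(v, E)`, by an amount that the bound can absorb
    obtain ⟨s, hs⟩ : ∃ s, s = infDist v (range f) + dist u v := ⟨_, rfl⟩
    have near : ∀ e, dist v (f e) ≤ 2 * s →
        (⨅ e, t u e) ≤ t v e + 15 * L * weightedDist (range f) u v := by
      intro e he
      refine (ciInf_le (hbdd u) e).trans ?_
      have h1 : dist u (f e) ≤ dist u v + dist v (f e) := dist_triangle _ _ _
      have h2 : dist u (f e) ^ 2 ≤ (dist u v + dist v (f e)) ^ 2 := by gcongr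
      have h3 : dist u v * dist v (f e) ≤ dist u v * (2 * s) := by gcongr
      have h4 : dist u (f e) ^ 2 ≤ dist v (f e) ^ 2 + 5 * weightedDist (range f) u v := by
        rw [weightedDist]
        rw [hs] at h3
        nlinarith [mul_nonneg hR.le hv0, mul_nonneg hR.le hu0]
      have h5 := mul_le_mul_of_nonneg_left h4 (by positivity : (0 : ℝ) ≤ 3 * L)
      simp only [t]
      linarith
    rw [sub_le_iff_le_add', ← sub_le_iff_le_add]
    refine le_ciInf fun e => ?_
    rw [sub_le_iff_le_add]
    rcases le_total (dist v (f e)) (2 * s) with he | he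
    · exact near e he
    · -- a point of the image much closer to `v` than `f e` gives a smaller value
      obtain ⟨_, ⟨e', rfl⟩, he'⟩ :=
        (infDist_lt_iff (range_nonempty f)).1 (show infDist v (range f) < s by linarith)
      refine (near e' (by linarith)).trans ?_
      have hd : (0 : ℝ) ≤ dist v (f e') := dist_nonneg
      have h1 : dist v (f e') ≤ dist v (f e) / 2 := by linarith
      have h2 : dist v (f e') ^ 2 ≤ (dist v (f e) / 2) ^ 2 := by gcongr
      have h3 : dist (f e) (f e') ^ 2 ≤ (3 * dist v (f e) / 2) ^ 2 := by
        have := dist_triangle_left (f e) (f e') v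
        gcongr
        linarith
      have h4 : dist p e' ≤ dist p e + L * (3 * dist v (f e) / 2) ^ 2 := by
        have := dist_triangle p e e'
        have := hf1 e e'
        have := mul_le_mul_of_nonneg_left h3 hL0.le
        linarith
      have h5 := mul_le_mul_of_nonneg_left h2 (by positivity : (0 : ℝ) ≤ 3 * L)
      simp only [t]
      nlinarith
  · have hR : 0 ≤ dist x y := dist_nonneg
    have hLi : 1 / (16 * L) ≤ 1 / 16 :=
      one_div_le_one_div_of_le (by norm_num) (by linarith)
    have hx : (⨅ e, t x e) ≤ 3 / (256 * L) * dist x y ^ 2 := by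
      refine (ciInf_le (hbdd x) p).trans ?_
      simp only [t, dist_self, zero_add]
      calc 3 * L * dist x (f p) ^ 2 ≤ 3 * L * (1 / (16 * L) * dist x y) ^ 2 := by gcongr
        _ = _ := by
          field_simp
          ring
    have hy : 1 / (16 * L) * dist x y ^ 2 ≤ ⨅ e, t y e := by
      refine le_ciInf fun e => ?_
      simp only [t]
      rcases le_total (dist x y / 4) (dist y (f e)) with he | he
      · have h1 : (dist x y / 4) ^ 2 ≤ dist y (f e) ^ 2 := by gcongr
        have h2 : 1 / (16 * L) * dist x y ^ 2 ≤ 1 / 16 * dist x y ^ 2 := by gcongr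
        have h3 : 0 ≤ dist p e := dist_nonneg
        nlinarith [sq_nonneg (dist y (f e))]
      · have h1 : dist x y / 2 ≤ dist (f p) (f e) := by
          have h2 := dist_triangle4 x (f p) (f e) y
          rw [dist_comm (f e) y] at h2
          nlinarith
        have h2 : (dist x y / 2) ^ 2 ≤ dist (f p) (f e) ^ 2 := by gcongr
        have h3 := h2.trans (hf2 p e)
        have h4 : 1 / (16 * L) * dist x y ^ 2 ≤ dist p e := by
          rw [div_mul_eq_mul_div, one_mul, div_le_iff₀ (by positivity)]
          nlinarith [dist_nonneg (x := p) (y := e), sq_nonneg (dist x y)]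
        have h5 : 0 ≤ 3 * L * dist y (f e) ^ 2 := by positivity
        linarith
    rw [abs_sub_comm]
    refine le_trans ?_ (le_abs_self _)
    have h1 : 1 / (32 * L) * dist x y ^ 2
        ≤ 1 / (16 * L) * dist x y ^ 2 - 3 / (256 * L) * dist x y ^ 2 := by
      rw [← sub_mul]
      gcongr
      rw [div_sub_div _ _ (by positivity) (by positivity), div_le_div_iff₀ (by positivity)
        (by positivity)]
      nlinarith [pow_pos hL0 2, pow_pos hL0 3]
    linarith

/-- If `f` is bilipschitz from the square-root snowflake of `X`, then the distance weighted by
`dist(·, f(X))` is comparable to a metric. -/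
theorem exists_isMetric_comparable_weightedDist {X Y : Type*} [MetricSpace X] [MetricSpace Y]
    [Nonempty X] {f : X → Y} {L : ℝ} (hL : 1 ≤ L)
    (hf1 : ∀ a b, dist a b ≤ L * dist (f a) (f b) ^ 2)
    (hf2 : ∀ a b, dist (f a) (f b) ^ 2 ≤ L * dist a b) :
    ∃ δ : Y → Y → ℝ, IsMetric δ ∧ ∀ x y, 1 / (4096 * L ^ 2) * weightedDist (range f) x y ≤ δ x y ∧
      δ x y ≤ weightedDist (range f) x y := by
  have hL0 : 0 < L := by linarith
  refine exists_isMetric_of_lipschitz_functions (by positivity)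
    (fun x y => weightedDist_pos _) fun x y => ?_
  rcases le_or_gt (1 / (16 * L) * dist x y) (infDist x (range f)) with hx | hx
  · have hε : 1 / (16 * L) ≤ 1 := by
      rw [div_le_one (by positivity)]
      linarith
    obtain ⟨g, hg, hgxy⟩ := exists_truncated_dist x y (by positivity) hε hx
    refine ⟨g, hg, le_trans (le_of_eq ?_) hgxy⟩
    congr 1
    field_simp
    norm_num
  · obtain ⟨_, ⟨p, rfl⟩, hp⟩ := (infDist_lt_iff (range_nonempty f)).1 hx
    obtain ⟨g, hg, hgxy⟩ := exists_quadratic_extension hL hf1 hf2 x y p hp.le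
    refine ⟨fun u => g u / (15 * L), fun u v => ?_, ?_⟩
    · rw [← sub_div, abs_div, abs_of_pos (by positivity : 0 < 15 * L),
        div_le_iff₀ (by positivity), mul_comm]
      exact hg u v
    · rw [← sub_div, abs_div, abs_of_pos (by positivity : 0 < 15 * L), le_div_iff₀ (by positivity)]
      refine le_trans ?_ hgxy
      have hR : 0 ≤ dist x y := dist_nonneg
      have hy : infDist y (range f) ≤ infDist x (range f) + dist x y := by
        rw [dist_comm]
        exact infDist_le_infDist_add_dist
      have hLi : 1 / (16 * L) ≤ 1 / 16 := one_div_le_one_div_of_le (by norm_num) (by linarith)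
      have hw : weightedDist (range f) x y ≤ 3 * dist x y ^ 2 := by
        have h1 : dist x y + infDist x (range f) + infDist y (range f) ≤ 3 * dist x y := by
          nlinarith
        calc weightedDist (range f) x y ≤ dist x y * (3 * dist x y) := by
              rw [weightedDist]
              gcongr
          _ = _ := by ring
      calc 1 / (4096 * L ^ 2) * weightedDist (range f) x y * (15 * L)
          ≤ 1 / (4096 * L ^ 2) * (3 * dist x y ^ 2) * (15 * L) := by gcongr
        _ = 45 / 4096 * (1 / L) * dist x y ^ 2 := by
          field_simp
          ring
        _ ≤ 1 / 32 * (1 / L) * dist x y ^ 2 := by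
          gcongr ?_ * _ * _
          norm_num
        _ = _ := by
          field_simp

/-! ### The weighted measure -/

/-- Lebesgue measure with density `dist(·, E) ^ N`. -/
noncomputable def weightedVolume {N : ℕ} (E : Set (EuclideanSpace ℝ (Fin N))) :
    Measure (EuclideanSpace ℝ (Fin N)) :=
  volume.withDensity fun x => ENNReal.ofReal (infDist x E ^ N)

/-- The volume of the unit ball of `ℝ^N`. -/
noncomputable def unitBallVolume (N : ℕ) : ℝ :=
  (volume (ball (0 : EuclideanSpace ℝ (Fin N)) 1)).toReal

theorem unitBallVolume_pos (N : ℕ) : 0 < unitBallVolume N :=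
  ENNReal.toReal_pos (measure_ball_pos _ _ one_pos).ne' measure_ball_lt_top.ne

theorem volume_closedBall_eq_ofReal {N : ℕ} (x : EuclideanSpace ℝ (Fin N)) {r : ℝ} (hr : 0 ≤ r) :
    volume (closedBall x r) = ENNReal.ofReal (r ^ N * unitBallVolume N) := by
  rw [Measure.addHaar_closedBall _ _ hr, finrank_euclideanSpace_fin,
    ENNReal.ofReal_mul (by positivity), unitBallVolume,
    ENNReal.ofReal_toReal measure_ball_lt_top.ne]

theorem weightedVolume_closedBall_le {N : ℕ} (E : Set (EuclideanSpace ℝ (Fin N)))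
    (x : EuclideanSpace ℝ (Fin N)) {r : ℝ} (hr : 0 ≤ r) :
    weightedVolume E (closedBall x r)
      ≤ ENNReal.ofReal ((r * (infDist x E + r)) ^ N * unitBallVolume N) := by
  have h0 : 0 ≤ infDist x E := infDist_nonneg
  rw [weightedVolume, withDensity_apply _ measurableSet_closedBall]
  calc ∫⁻ y in closedBall x r, ENNReal.ofReal (infDist y E ^ N)
      ≤ ∫⁻ _ in closedBall x r, ENNReal.ofReal ((infDist x E + r) ^ N) := by
        refine setLIntegral_mono measurable_const fun y hy => ENNReal.ofReal_le_ofReal ?_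
        have h1 : infDist y E ≤ infDist x E + dist y x := infDist_le_infDist_add_dist
        have h2 : dist y x ≤ r := hy
        exact pow_le_pow_left₀ infDist_nonneg (by linarith) N
    _ = _ := by
        rw [setLIntegral_const, volume_closedBall_eq_ofReal x hr,
          ← ENNReal.ofReal_mul (by positivity), mul_pow]
        congr 1
        ring

/-- Every ball contains a ball of comparable radius that stays away from a subset `E` of a
coordinate hyperplane. -/
theorem exists_closedBall_far_from {N : ℕ} {E : Set (EuclideanSpace ℝ (Fin N))} (i₀ : Fin N)
    (hE : E.Nonempty) (hE0 : ∀ x ∈ E, x i₀ = 0) (x : EuclideanSpace ℝ (Fin N)) {r : ℝ}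
    (hr : 0 ≤ r) :
    ∃ z, closedBall z (r / 4) ⊆ closedBall x r ∧
      ∀ y ∈ closedBall z (r / 4), (infDist x E + r) / 8 ≤ infDist y E := by
  have hnear : ∀ z y, y ∈ closedBall z (r / 4) → infDist z E ≤ infDist y E + r / 4 := by
    intro z y hy
    have h1 : infDist z E ≤ infDist y E + dist z y := infDist_le_infDist_add_dist
    have h2 : dist y z ≤ r / 4 := hy
    rw [dist_comm] at h2
    linarith
  rcases le_or_gt r (infDist x E) with hx | hx
  · refine ⟨x, closedBall_subset_closedBall (by linarith), fun y hy => ?_⟩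
    have := hnear x y hy
    linarith
  · -- move away from the hyperplane in the orthogonal direction
    obtain ⟨s, hs, hxs⟩ : ∃ s : ℝ, |s| = r / 2 ∧ r / 2 ≤ |x i₀ + s| := by
      rcases le_total 0 (x i₀) with h | h
      · exact ⟨r / 2, abs_of_nonneg (by linarith), by rw [abs_of_nonneg] <;> linarith⟩
      · exact ⟨-(r / 2), by rw [abs_neg, abs_of_nonneg (by linarith)],
          by rw [abs_of_nonpos] <;> linarith⟩
    refine ⟨x + EuclideanSpace.single i₀ s, closedBall_subset_closedBall' ?_, fun y hy => ?_⟩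
    · rw [dist_eq_norm, add_sub_cancel_left, PiLp.norm_single, Real.norm_eq_abs, hs]
      linarith
    · have h1 := hnear _ y hy
      have h2 : r / 2 ≤ infDist (x + EuclideanSpace.single i₀ s) E := by
        refine (le_infDist hE).2 fun e he => ?_
        have h3 := PiLp.norm_apply_le (x + EuclideanSpace.single i₀ s - e) i₀
        rw [dist_eq_norm]
        refine hxs.trans ?_
        simpa [hE0 e he] using h3
      linarith

theorem le_weightedVolume_closedBall {N : ℕ} {E : Set (EuclideanSpace ℝ (Fin N))} (i₀ : Fin N)
    (hE : E.Nonempty) (hE0 : ∀ x ∈ E, x i₀ = 0) (x : EuclideanSpace ℝ (Fin N)) {r : ℝ}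
    (hr : 0 ≤ r) :
    ENNReal.ofReal ((r * (infDist x E + r) / 32) ^ N * unitBallVolume N)
      ≤ weightedVolume E (closedBall x r) := by
  have h0 : 0 ≤ infDist x E := infDist_nonneg
  obtain ⟨z, hzx, hz⟩ := exists_closedBall_far_from i₀ hE hE0 x hr
  refine le_trans ?_ (measure_mono hzx)
  rw [weightedVolume, withDensity_apply _ measurableSet_closedBall]
  calc ENNReal.ofReal ((r * (infDist x E + r) / 32) ^ N * unitBallVolume N)
      = ∫⁻ _ in closedBall z (r / 4), ENNReal.ofReal (((infDist x E + r) / 8) ^ N) := by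
        rw [setLIntegral_const, volume_closedBall_eq_ofReal z (by linarith),
          ← ENNReal.ofReal_mul (by positivity), ← mul_assoc, ← mul_pow]
        congr 3
        ring
    _ ≤ _ := by
        refine setLIntegral_mono' measurableSet_closedBall fun y hy => ENNReal.ofReal_le_ofReal ?_
        exact pow_le_pow_left₀ (by positivity) (hz y hy) N

theorem isDoublingMeasure_weightedVolume {N : ℕ} {E : Set (EuclideanSpace ℝ (Fin N))}
    (i₀ : Fin N) (hE : E.Nonempty) (hE0 : ∀ x ∈ E, x i₀ = 0) :
    IsDoublingMeasure (weightedVolume E) (128 ^ N) where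
  pos x r hr := by
    have h0 : 0 ≤ infDist x E := infDist_nonneg
    have := unitBallVolume_pos N
    exact (ENNReal.ofReal_pos.2 (by positivity)).trans_le
      (le_weightedVolume_closedBall i₀ hE hE0 x hr.le)
  finite x r hr := (weightedVolume_closedBall_le E x hr.le).trans_lt ENNReal.ofReal_lt_top
  doubling x r hr := by
    have h0 : 0 ≤ infDist x E := infDist_nonneg
    have hω := unitBallVolume_pos N
    refine (weightedVolume_closedBall_le E x (by linarith)).trans ?_
    refine le_trans ?_ (mul_le_mul_right (le_weightedVolume_closedBall i₀ hE hE0 x hr.le) _)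
    rw [← ENNReal.ofReal_mul (by positivity), ← mul_assoc, ← mul_pow]
    refine ENNReal.ofReal_le_ofReal ?_
    gcongr ?_ ^ N * _
    nlinarith [mul_nonneg hr.le h0]

theorem measureQuasimetric_weightedVolume_le {N : ℕ} (hN : N ≠ 0)
    (E : Set (EuclideanSpace ℝ (Fin N))) (x y : EuclideanSpace ℝ (Fin N)) :
    measureQuasimetric (weightedVolume E) (1 / (N : ℝ)) x y
      ≤ (2 * unitBallVolume N) ^ (1 / (N : ℝ)) * weightedDist E x y := by
  have hω := unitBallVolume_pos N
  have hw := weightedDist_nonneg E x y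
  have hR : 0 ≤ dist x y := dist_nonneg
  have hx : 0 ≤ infDist x E := infDist_nonneg
  have hy : 0 ≤ infDist y E := infDist_nonneg
  have bound : ∀ z, infDist z E ≤ infDist x E + infDist y E →
      (weightedVolume E (closedBall z (dist x y))).toReal
        ≤ weightedDist E x y ^ N * unitBallVolume N := by
    intro z hz
    have hz0 : 0 ≤ infDist z E := infDist_nonneg
    refine (ENNReal.toReal_le_of_le_ofReal (by positivity)
      (weightedVolume_closedBall_le E z hR)).trans ?_
    rw [weightedDist]
    gcongr ?_ ^ N * _
    exact mul_le_mul_of_nonneg_left (by linarith) hR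
  have h1 := bound x (by linarith)
  have h2 := bound y (by linarith)
  rw [measureQuasimetric, ← Real.pow_rpow_inv_natCast hw hN, ← one_div,
    ← Real.mul_rpow (by positivity) (by positivity)]
  exact Real.rpow_le_rpow (by positivity) (by linarith) (by positivity)

theorem le_measureQuasimetric_weightedVolume {N : ℕ} {E : Set (EuclideanSpace ℝ (Fin N))}
    (i₀ : Fin N) (hE : E.Nonempty) (hE0 : ∀ x ∈ E, x i₀ = 0) (x y : EuclideanSpace ℝ (Fin N)) :
    (unitBallVolume N) ^ (1 / (N : ℝ)) / 64 * weightedDist E x y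
      ≤ measureQuasimetric (weightedVolume E) (1 / (N : ℝ)) x y := by
  have hN : N ≠ 0 := by
    rintro rfl
    exact i₀.elim0
  have hω := unitBallVolume_pos N
  have hw := weightedDist_nonneg E x y
  have hR : 0 ≤ dist x y := dist_nonneg
  have bound : ∀ z, weightedDist E x y / 2 ≤ dist x y * (infDist z E + dist x y) →
      (weightedDist E x y / 64) ^ N * unitBallVolume N
        ≤ (weightedVolume E (closedBall z (dist x y))).toReal := by
    intro z hz
    have hz0 : 0 ≤ infDist z E := infDist_nonneg
    refine le_trans ?_ ((ENNReal.ofReal_le_iff_le_toReal ?_).1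
      (le_weightedVolume_closedBall i₀ hE hE0 z hR))
    · gcongr ?_ ^ N * _
      linarith
    · exact ((weightedVolume_closedBall_le E z hR).trans_lt ENNReal.ofReal_lt_top).ne
  have key : (weightedDist E x y / 64) ^ N * unitBallVolume N
      ≤ (weightedVolume E (closedBall x (dist x y))).toReal
        + (weightedVolume E (closedBall y (dist x y))).toReal := by
    rcases le_total (infDist x E) (infDist y E) with h | h
    · refine (bound y ?_).trans (le_add_of_nonneg_left ENNReal.toReal_nonneg)
      rw [weightedDist]
      nlinarith
    · refine (bound x ?_).trans (le_add_of_nonneg_right ENNReal.toReal_nonneg)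
      rw [weightedDist]
      nlinarith
  calc (unitBallVolume N) ^ (1 / (N : ℝ)) / 64 * weightedDist E x y
      = ((weightedDist E x y / 64) ^ N * unitBallVolume N) ^ (1 / (N : ℝ)) := by
        rw [Real.mul_rpow (by positivity) hω.le, one_div,
          Real.pow_rpow_inv_natCast (by positivity) hN]
        ring
    _ ≤ _ := Real.rpow_le_rpow (by positivity) key (by positivity)

/-! ### Sampling under bilipschitz maps -/

theorem IsBilipschitz.isSamplingEquivalence {X Y : Type*} [MetricSpace X] {δ : Y → Y → ℝ}
    {f : X → Y} {L : ℝ} (hδ : IsMetric δ) (hL : 1 ≤ L)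
    (hf : IsBilipschitz (fun x y : X => dist x y) δ f L) :
    IsSamplingEquivalence (fun x y : X => dist x y) δ f L := by
  have hL0 : 0 < L := by linarith
  have hup : ∀ {x y r}, dist x y < r → δ (f x) (f y) < L * r := fun {x y r} h =>
    (hf x y).2.trans_lt (by gcongr)
  have hlow : ∀ {x y r}, δ (f x) (f y) < r → dist x y < L * r := fun {x y r} h => by
    have := (hf x y).1.trans_lt h
    rwa [inv_mul_lt_iff₀ hL0] at this
  have hcancel : ∀ r, L * (r / L) = r := fun r => by field_simp
  have hinj : Function.Injective f := fun x y hxy => by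
    have h := (hf x y).1
    rw [hxy, (hδ.eq_zero_iff _ _).2 rfl] at h
    have h2 : dist x y ≤ 0 := by
      have := mul_le_mul_of_nonneg_left h hL0.le
      rwa [mul_inv_cancel_left₀ hL0.ne', mul_zero] at this
    exact dist_le_zero.1 h2
  refine ⟨fun A ε _ hA => ⟨image_subset_range _ _, ?_⟩, fun B ε _ hB => ⟨subset_univ _, ?_⟩,
    fun A r _ hA => ⟨image_subset_range _ _, ?_⟩, fun B r _ hB => ⟨subset_univ _, ?_⟩⟩
  · rintro _ ⟨x, rfl⟩
    obtain ⟨a, ha, hax⟩ := hA.2 x (mem_univ x)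
    exact ⟨f a, mem_image_of_mem f ha, hup hax⟩
  · intro x _
    obtain ⟨b, hb, hbx⟩ := hB.2 (f x) (mem_range_self x)
    obtain ⟨a, rfl⟩ := hB.1 hb
    exact ⟨a, hb, hlow hbx⟩
  · rintro _ ⟨a, ha, rfl⟩ _ ⟨b, hb, rfl⟩ hab
    refine disjoint_left.2 ?_
    rintro _ ⟨⟨x, rfl⟩, hax⟩ ⟨-, hbx⟩
    have h1 := hlow hax
    have h2 := hlow hbx
    rw [hcancel] at h1 h2
    exact disjoint_left.1 (hA.2 a ha b hb fun h => hab (h ▸ rfl)) ⟨mem_univ x, h1⟩ ⟨mem_univ x, h2⟩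
  · intro a ha b hb hab
    refine disjoint_left.2 ?_
    rintro x ⟨-, hax⟩ ⟨-, hbx⟩
    have h1 := hup hax
    have h2 := hup hbx
    rw [hcancel] at h1 h2
    exact disjoint_left.1 (hB.2 (f a) ha (f b) hb (hinj.ne hab))
      ⟨mem_range_self x, h1⟩ ⟨mem_range_self x, h2⟩

/-! ### The deformation of Euclidean space along a snowflake -/

/-- If `f` is bilipschitz from the square-root snowflake of `X` into a coordinate hyperplane, then
Lebesgue measure with density `dist(·, f(X)) ^ N` is a metric doubling measure whose metric makes
`f` bilipschitz on `X` itself. The constants depend only on `N` and `L`. -/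
theorem exists_metricDoublingMeasure_of_snowflake {X : Type*} [MetricSpace X] [Nonempty X] {N : ℕ}
    {f : X → EuclideanSpace ℝ (Fin N)} {L : ℝ} (i₀ : Fin N) (hf0 : ∀ x, f x i₀ = 0) (hL : 1 ≤ L)
    (hf1 : ∀ a b, dist a b ≤ L * dist (f a) (f b) ^ 2)
    (hf2 : ∀ a b, dist (f a) (f b) ^ 2 ≤ L * dist a b) {C : ℝ}
    (hC1 : 64 ≤ C * unitBallVolume N ^ (1 / (N : ℝ)))
    (hC2 : 4096 * L ^ 2 * (2 * unitBallVolume N) ^ (1 / (N : ℝ)) ≤ C) :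
    ∃ (μ : Measure (EuclideanSpace ℝ (Fin N)))
      (δ : EuclideanSpace ℝ (Fin N) → EuclideanSpace ℝ (Fin N) → ℝ),
      IsMetricDoublingMeasure μ δ (128 ^ N) C ∧
      IsBilipschitz (fun x y : X => dist x y) δ f (4096 * L ^ 3) := by
  have hN : N ≠ 0 := by
    rintro rfl
    exact i₀.elim0
  have hL0 : 0 < L := by linarith
  have hω := unitBallVolume_pos N
  have hC : 0 < C := lt_of_lt_of_le (by positivity) hC2
  have hE : (range f).Nonempty := range_nonempty f
  have hE0 : ∀ x ∈ range f, x i₀ = 0 := by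
    rintro _ ⟨x, rfl⟩
    exact hf0 x
  obtain ⟨δ, hδ, hδw⟩ := exists_isMetric_comparable_weightedDist hL hf1 hf2
  have hwδ : ∀ x y, weightedDist (range f) x y ≤ 4096 * L ^ 2 * δ x y := fun x y => by
    have := (hδw x y).1
    rwa [div_mul_eq_mul_div, one_mul, div_le_iff₀ (by positivity), mul_comm] at this
  have hδ0 : ∀ x y, 0 ≤ δ x y := fun x y => by
    have := (weightedDist_nonneg (range f) x y).trans (hwδ x y)
    exact nonneg_of_mul_nonneg_right this (by positivity)
  refine ⟨weightedVolume (range f), δ, ⟨isDoublingMeasure_weightedVolume i₀ hE hE0, hδ,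
    fun x y => ⟨?_, ?_⟩⟩, fun x y => ⟨?_, ?_⟩⟩
  · rw [inv_mul_le_iff₀ hC]
    calc δ x y ≤ weightedDist (range f) x y := (hδw x y).2
      _ = 64 / 64 * weightedDist (range f) x y := by ring
      _ ≤ C * unitBallVolume N ^ (1 / (N : ℝ)) / 64 * weightedDist (range f) x y := by
        have := weightedDist_nonneg (range f) x y
        gcongr
      _ = C * (unitBallVolume N ^ (1 / (N : ℝ)) / 64 * weightedDist (range f) x y) := by ring
      _ ≤ _ := by
        gcongr
        exact le_measureQuasimetric_weightedVolume i₀ hE hE0 x y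
  · calc measureQuasimetric (weightedVolume (range f)) (1 / (N : ℝ)) x y
        ≤ (2 * unitBallVolume N) ^ (1 / (N : ℝ)) * weightedDist (range f) x y :=
          measureQuasimetric_weightedVolume_le hN _ x y
      _ ≤ (2 * unitBallVolume N) ^ (1 / (N : ℝ)) * (4096 * L ^ 2 * δ x y) := by
        gcongr
        exact hwδ x y
      _ = 4096 * L ^ 2 * (2 * unitBallVolume N) ^ (1 / (N : ℝ)) * δ x y := by ring
      _ ≤ C * δ x y := mul_le_mul_of_nonneg_right hC2 (hδ0 x y)
  · have h := hwδ (f x) (f y)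
    rw [weightedDist_of_mem (mem_range_self x) (mem_range_self y)] at h
    rw [inv_mul_le_iff₀ (by positivity)]
    calc dist x y ≤ L * dist (f x) (f y) ^ 2 := hf1 x y
      _ ≤ L * (4096 * L ^ 2 * δ (f x) (f y)) := by gcongr
      _ = _ := by ring
  · have h := (hδw (f x) (f y)).2
    rw [weightedDist_of_mem (mem_range_self x) (mem_range_self y)] at h
    refine (h.trans (hf2 x y)).trans ?_
    gcongr
    have := pow_le_pow_left₀ zero_le_one hL 2
    nlinarith

/-! ### Embedding doubling spaces -/

theorem mainTheorem1 (D : ℕ) :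
    ∃ (N : ℕ) (K C L : ℝ), 1 ≤ N ∧ 1 ≤ K ∧ 1 ≤ C ∧ 1 ≤ L ∧
      ∀ (X : Type*) [MetricSpace X], IsDoublingSpace X D →
        ∃ (μ : Measure (EuclideanSpace ℝ (Fin N)))
          (δ : EuclideanSpace ℝ (Fin N) → EuclideanSpace ℝ (Fin N) → ℝ)
          (f : X → EuclideanSpace ℝ (Fin N)),
          IsMetricDoublingMeasure μ δ K C ∧
          IsBilipschitz (fun x y : X => dist x y) δ f L ∧
          IsSamplingEquivalence (fun x y : X => dist x y) δ f L := by
  obtain ⟨N, hN⟩ : ∃ N, N = D ^ 7 * 9 + 1 := ⟨_, rfl⟩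
  obtain ⟨M, hM⟩ : ∃ M : ℝ, M = 512 + (D ^ 7 * 9 : ℕ) * 2 ^ 25 := ⟨_, rfl⟩
  have hM1 : 512 ≤ M := by
    rw [hM]
    exact le_add_of_nonneg_right (by positivity)
  have hω := unitBallVolume_pos N
  let w : ℝ := unitBallVolume N ^ (1 / (N : ℝ))
  have hw : 0 < w := by positivity
  let C : ℝ := 1 + 64 / w + 4096 * M ^ 2 * (2 * unitBallVolume N) ^ (1 / (N : ℝ))
  have hb : 0 ≤ 4096 * M ^ 2 * (2 * unitBallVolume N) ^ (1 / (N : ℝ)) := by positivity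
  have hwi : 0 < 64 / w := by positivity
  have hC1 : 64 ≤ C * w := by
    rw [← div_le_iff₀ hw]
    simp only [C]
    linarith
  have hC2 : 4096 * M ^ 2 * (2 * unitBallVolume N) ^ (1 / (N : ℝ)) ≤ C := by
    simp only [C]
    linarith
  have hL : 1 ≤ 4096 * M ^ 3 := by
    have : 1 ≤ M ^ 3 := one_le_pow₀ (by linarith)
    linarith
  subst hN
  refine ⟨D ^ 7 * 9 + 1, 128 ^ (D ^ 7 * 9 + 1), C, 4096 * M ^ 3, Nat.le_add_left 1 _,
    one_le_pow₀ (by norm_num), by simp only [C]; linarith, hL, fun X _ hX => ?_⟩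
  rcases isEmpty_or_nonempty X with hempty | hne
  · -- the measure of a one-point space serves for the empty one
    obtain ⟨μ, δ, hμ, -⟩ := exists_metricDoublingMeasure_of_snowflake (X := Unit)
      (f := fun _ => 0) (0 : Fin (D ^ 7 * 9 + 1)) (by simp) (by linarith : 1 ≤ M) (by simp)
      (by simp) hC1 hC2
    have hf : IsBilipschitz (fun x y : X => dist x y) δ (fun _ => 0) (4096 * M ^ 3) :=
      fun x => hempty.elim x
    exact ⟨μ, δ, _, hμ, hf, hf.isSamplingEquivalence hμ.metric hL⟩
  · obtain ⟨f, hf0, hf1, hf2⟩ := hX.exists_snowflake_embedding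
    obtain ⟨μ, δ, hμ, hf⟩ := exists_metricDoublingMeasure_of_snowflake 0 hf0
      (by linarith : 1 ≤ M)
      (fun x y => (hf1 x y).trans (by gcongr))
      (fun x y => (hf2 x y).trans (by gcongr; rw [hM]; linarith)) hC1 hC2
    exact ⟨μ, δ, f, hμ, hf, hf.isSamplingEquivalence hμ.metric hL⟩
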